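/- Let $\mathbb D$ be the open unit disc in $\mathbb C$, $\mathbb N=\{1,2,\ldots\}$, and let $m\ge 2$ be an integer. For $p\in(0,\infty)^n$ put $\mathcal E(p)=\{z\in\mathbb C^n:|z_1|^{2p_1}+\ldots+|z_n|^{2p_n}<1\}$. For a domain $D\subset\mathbb C^n$, a holomorphic map $f:\mathbb D\to D$ is an \emph{$l$-extremal} if for no pairwise distinct points $\lambda_1,\ldots,\lambda_l\in\mathbb D$ is there a map $h$, holomorphic in a neighbourhood of $\overline{\mathbb D}$ with values in $D$, such that $h(\lambda_i)=f(\lambda_i)$ for $i=1,\ldots,l$. Let $\mathcal S_n\subset[1/2,\infty)^n$ be the smallest set such that $(1/2,\ldots,1/2)\in\mathcal S_n$, and such that $q\in\mathcal S_n$ implies $cq\in\mathcal S_n$ for every $c\ge 1$ and $\{1,q_1,\ldots,q_n\}^n\subset\mathcal S_n$. Let $p\in(0,\infty)^n$, $q\in\mathcal S_n$, and let $f:\mathbb D\to\mathcal E(p)$ be a non-constant map of the form $$f_j(\lambda)=a_j\prod_{k=1}^{m-1}\left(\frac{\lambda-\alpha_{kj}}{1-\overline{\alpha_{kj}}\lambda}\right)^{r_{kj}}\left(\frac{1-\overline{\alpha_{kj}}\lambda}{1-\overline{\alpha_{k0}}\lambda}\right)^{1/p_j},\quad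 j=1,\ldots,n,$$ with the principal branch of the powers, where $a_j\in\mathbb C\setminus\{0\}$, $\alpha_{kj}\in\overline{\mathbb D}$, $\alpha_{k0}\in\mathbb D$, $r_{kj}\in\{0,1\}$ and $$\sum_{j=1}^n|a_j|^{2p_j}\prod_{k=1}^{m-1}(\lambda-\alpha_{kj})(1-\overline{\alpha_{kj}}\lambda)=\prod_{k=1}^{m-1}(\lambda-\alpha_{k0})(1-\overline{\alpha_{k0}}\lambda),\quad\lambda\in\mathbb C.$$ (1) Suppose that $p_1,\ldots,p_n\ge 1/2$. Put $J=\{j:p_j/q_j\notin\mathbb N\}$ and $s_j=\#\{k:r_{kj}=1\}$, and suppose that $\alpha_{kj}\in\mathbb D$ and $r_{kj}=0$ for all $k=1,\ldots,m-1$ and $j\in J$. Then $f$ is an $\tilde m$-extremal of $\mathcal E(p)$, where $\tilde m=m+\sum_{j\notin J}(p_j/q_j-1)s_j$. (2) In particular, if $p_j/q_j\in\mathbb N$ for $j=1,\ldots,n$, then $f$ is an $\bigl(m+(m-1)(p_1/q_1+\ldots+p_n/q_n-n)\bigr)$-extremal of $\mathcal E(p)$. -/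

import Mathlib

open scoped ComplexConjugate

/-- The complex ellipsoid `{z ∈ ℂⁿ : |z₁|^(2p₁) + ⋯ + |zₙ|^(2pₙ) < 1}`. -/
def complexEllipsoid {n : ℕ} (p : Fin n → ℝ) : Set (Fin n → ℂ) :=
  {z | ∑ j, ‖z j‖ ^ (2 * p j) < 1}

/-- `h` is holomorphic in a neighbourhood of the closed unit disc, with values in `D`. -/
def HolomorphicNearClosedDisc {n : ℕ} (D : Set (Fin n → ℂ)) (h : ℂ → Fin n → ℂ) : Prop :=
  ∃ U : Set ℂ, IsOpen U ∧ Metric.closedBall 0 1 ⊆ U ∧ DifferentiableOn ℂ h U ∧ Set.MapsTo h U D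

/-- `f` is a weak `m`-extremal of `D` for the points `pt 0, …, pt (m - 1)`.
Only the values of `f` on the open unit disc matter. -/
def IsWeakExtremalFor {n : ℕ} (D : Set (Fin n → ℂ)) (m : ℕ) (pt : Fin m → ℂ)
    (f : ℂ → Fin n → ℂ) : Prop :=
  DifferentiableOn ℂ f (Metric.ball 0 1) ∧ Set.MapsTo f (Metric.ball 0 1) D ∧
    ¬ ∃ h : ℂ → Fin n → ℂ, HolomorphicNearClosedDisc D h ∧ ∀ l, h (pt l) = f (pt l)

/-- `f` is an `m`-extremal of `D`: a holomorphic map of the unit disc into `D` which is a weak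
`m`-extremal for every choice of `m` pairwise distinct points of the disc. -/
def IsExtremal {n : ℕ} (D : Set (Fin n → ℂ)) (m : ℕ) (f : ℂ → Fin n → ℂ) : Prop :=
  DifferentiableOn ℂ f (Metric.ball 0 1) ∧ Set.MapsTo f (Metric.ball 0 1) D ∧
    ∀ pt : Fin m → ℂ, Function.Injective pt → (∀ l, pt l ∈ Metric.ball (0 : ℂ) 1) →
      IsWeakExtremalFor D m pt f

/-- The set `𝒮ₙ ⊆ [1/2, ∞)ⁿ`: the smallest set containing `(1/2, …, 1/2)`, closed under
multiplication by constants `c ≥ 1`, and containing `{1, p₁, …, pₙ}ⁿ` along with each `p`. -/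
inductive MemS {n : ℕ} : (Fin n → ℝ) → Prop
  | half : MemS (fun _ => 1 / 2)
  | scale (c : ℝ) (p : Fin n → ℝ) (hc : 1 ≤ c) (hp : MemS p) : MemS (fun j => c * p j)
  | replace (p q : Fin n → ℝ) (hp : MemS p) (hq : ∀ j, q j = 1 ∨ ∃ i, q j = p i) : MemS q

/-- `f` is a non-constant map of the unit disc into the ellipsoid of exponent `p` having
Edigarian's form with parameters `a`, `α`, `α₀`, `r`. On the unit disc the quotients
`(1 - conj (α k j) z) / (1 - conj (α₀ k) z)` avoid the half-line `(-∞, 0]`, so the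
principal power is holomorphic there. -/
structure HasEdigarianForm {n : ℕ} (m : ℕ) (p : Fin n → ℝ) (a : Fin n → ℂ)
    (α : Fin (m - 1) → Fin n → ℂ) (α₀ : Fin (m - 1) → ℂ) (r : Fin (m - 1) → Fin n → ℕ)
    (f : ℂ → Fin n → ℂ) : Prop where
  mapsTo : Set.MapsTo f (Metric.ball 0 1) (complexEllipsoid p)
  a_ne_zero : ∀ j, a j ≠ 0
  norm_α_le : ∀ k j, ‖α k j‖ ≤ 1
  norm_α₀_lt : ∀ k, ‖α₀ k‖ < 1
  r_mem : ∀ k j, r k j = 0 ∨ r k j = 1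
  sum_eq : ∀ z : ℂ,
    ∑ j, ((‖a j‖ ^ (2 * p j) : ℝ) : ℂ) * ∏ k, ((z - α k j) * (1 - conj (α k j) * z)) =
      ∏ k, ((z - α₀ k) * (1 - conj (α₀ k) * z))
  not_const : ¬ ∃ c, ∀ z ∈ Metric.ball (0 : ℂ) 1, f z = c
  formula : ∀ z ∈ Metric.ball (0 : ℂ) 1, ∀ j,
    f z j = a j * ∏ k, (((z - α k j) / (1 - conj (α k j) * z)) ^ (r k j) *
      ((1 - conj (α k j) * z) / (1 - conj (α₀ k) * z)) ^ ((1 / p j : ℝ) : ℂ))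

/-- `x` is a natural number, zero excluded. -/
def IsPosNat (x : ℝ) : Prop := ∃ N : ℕ, 0 < N ∧ x = N

/-! ### Elementary facts on the closed unit disc -/

/-! Both numbers in the theorem are integers `≥ m`, and in part (2) `p j ≥ q j ≥ 1/2`. So it
suffices that `f` is an `m`-extremal when all `p j ≥ 1/2`, that is, when `ρ(z) = ∑ |z_j|^(2 p_j)` is
convex.

This is a duality argument. The factors of `f j` divide `P j = |a_j|^(2 p_j) ∏ (z - α k j) (1 - conj
(α k j) z)`, with quotient `B j` continuous up to the circle (`exists_diffContOnCl_factor`). There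
`p j * B j` is `z^(m-1)` times a positive function times `∂ρ/∂z_j` at the boundary value of `f`,
which lies on `ρ = 1`. If `h` has values in the ellipsoid, convexity (`rpow_tangent_le`) makes the
real part of `z^(1-m) G` negative on the circle, where `G = ∑ p_j (B_j h_j - P_j)`. But `G` vanishes
wherever `h = f`, and by the maximum principle such a `G` has at most `m - 1` zeros
(`DiffContOnCl.ne_zero_of_re_neg_of_zeros`). -/

theorem Complex.re_one_sub_pos_or_eq_one {w : ℂ} (hw : ‖w‖ ≤ 1) : 0 < (1 - w).re ∨ w = 1 := by
  by_cases h : w.re < 1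
  · left
    simpa using h
  · right
    have h1 : w.re ≤ ‖w‖ := Complex.re_le_norm w
    have h2 : w.re = 1 := by linarith
    have h3 : w.re * w.re + w.im * w.im = ‖w‖ ^ 2 := by
      rw [← Complex.normSq_apply, Complex.normSq_eq_norm_sq]
    have h4 : w.im = 0 := by
      have : ‖w‖ ^ 2 ≤ 1 := pow_le_one₀ (norm_nonneg _) hw
      rw [h2] at h3
      nlinarith [sq_nonneg w.im]
    exact Complex.ext (by simpa using h2) (by simpa using h4)

theorem Complex.re_one_sub_pos {w : ℂ} (hw : ‖w‖ < 1) : 0 < (1 - w).re := by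
  have := (Complex.re_le_norm w).trans_lt hw
  simpa using this

/-- The arguments of `u` and `v` both lie in `(-π/2, π/2)`, so they differ by less than `π`. This
makes the principal powers in the formula for `f` holomorphic. -/
theorem Complex.div_mem_slitPlane_of_re_pos {u v : ℂ} (hu : 0 < u.re) (hv : 0 < v.re) :
    u / v ∈ Complex.slitPlane := by
  have hv0 : v ≠ 0 := by
    rintro rfl
    simp at hv
  by_contra h
  rw [Complex.mem_slitPlane_iff, not_or, not_lt, not_not] at h
  have hre : u.re = (u / v).re * v.re := by
    conv_lhs => rw [← div_mul_cancel₀ u hv0]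
    rw [Complex.mul_re, h.2]
    ring
  nlinarith [h.1]

theorem norm_conj_mul_lt_one_left {a z : ℂ} (ha : ‖a‖ < 1) (hz : ‖z‖ ≤ 1) :
    ‖conj a * z‖ < 1 := by
  rw [norm_mul, RCLike.norm_conj]
  nlinarith [norm_nonneg a, norm_nonneg z]

theorem norm_conj_mul_lt_one_right {a z : ℂ} (ha : ‖a‖ ≤ 1) (hz : ‖z‖ < 1) :
    ‖conj a * z‖ < 1 := by
  rw [norm_mul, RCLike.norm_conj]
  nlinarith [norm_nonneg a, norm_nonneg z]

theorem one_sub_conj_mul_ne_zero_left {a z : ℂ} (ha : ‖a‖ < 1) (hz : ‖z‖ ≤ 1) :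
    1 - conj a * z ≠ 0 := fun h => by
  have := Complex.re_one_sub_pos (norm_conj_mul_lt_one_left ha hz)
  simp [h] at this

theorem one_sub_conj_mul_ne_zero_right {a z : ℂ} (ha : ‖a‖ ≤ 1) (hz : ‖z‖ < 1) :
    1 - conj a * z ≠ 0 := fun h => by
  have := Complex.re_one_sub_pos (norm_conj_mul_lt_one_right ha hz)
  simp [h] at this

/-- On the unit circle `(z - a) (1 - conj a z) = z |1 - conj a z|²`. -/
theorem sub_mul_one_sub_conj_mul {z : ℂ} (hz : ‖z‖ = 1) (a : ℂ) :
    (z - a) * (1 - conj a * z) = z * ((‖1 - conj a * z‖ ^ 2 : ℝ) : ℂ) := by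
  have hzz : z * conj z = 1 := by
    rw [Complex.mul_conj, Complex.normSq_eq_norm_sq, hz]
    simp
  rw [← Complex.normSq_eq_norm_sq, Complex.normSq_eq_conj_mul_self]
  simp only [map_sub, map_one, map_mul, Complex.conj_conj]
  linear_combination (a * (1 - conj a * z)) * hzz

theorem norm_sub_eq_norm_one_sub_conj_mul {z : ℂ} (hz : ‖z‖ = 1) (a : ℂ) :
    ‖z - a‖ = ‖1 - conj a * z‖ := by
  have hzz : z * conj z = 1 := by
    rw [Complex.mul_conj, Complex.normSq_eq_norm_sq, hz]
    simp
  have h : z - a = z * conj (1 - conj a * z) := by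
    simp only [map_sub, map_one, map_mul, Complex.conj_conj]
    linear_combination a * hzz
  rw [h, norm_mul, hz, RCLike.norm_conj, one_mul]

/-! ### Dividing out zeros and the maximum principle -/

theorem DiffContOnCl.exists_eq_sub_mul {F : ℂ → ℂ} (hF : DiffContOnCl ℂ F (Metric.ball 0 1))
    {w : ℂ} (hw : w ∈ Metric.ball (0 : ℂ) 1) (hFw : F w = 0) :
    ∃ F₁ : ℂ → ℂ, DiffContOnCl ℂ F₁ (Metric.ball 0 1) ∧ ∀ z, F z = (z - w) * F₁ z := by
  have hnhds : Metric.ball (0 : ℂ) 1 ∈ nhds w := Metric.isOpen_ball.mem_nhds hw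
  refine ⟨dslope F w, ⟨?_, ?_⟩, fun z => ?_⟩
  · exact (Complex.differentiableOn_dslope hnhds).2 hF.differentiableOn
  · refine (continuousOn_dslope (Filter.mem_of_superset hnhds subset_closure)).2
      ⟨hF.continuousOn, hF.differentiableOn.differentiableAt hnhds⟩
  · have := sub_smul_dslope F w z
    rw [hFw, sub_zero, smul_eq_mul] at this
    exact this.symm

theorem DiffContOnCl.exists_eq_prod_sub_mul (S : Finset ℂ) {F : ℂ → ℂ}
    (hF : DiffContOnCl ℂ F (Metric.ball 0 1)) (hS : ∀ w ∈ S, w ∈ Metric.ball (0 : ℂ) 1)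
    (hFS : ∀ w ∈ S, F w = 0) :
    ∃ F₁ : ℂ → ℂ, DiffContOnCl ℂ F₁ (Metric.ball 0 1) ∧
      ∀ z, F z = (∏ w ∈ S, (z - w)) * F₁ z := by
  classical
  induction S using Finset.induction_on generalizing F with
  | empty => exact ⟨F, hF, fun z => by simp⟩
  | insert w S hwS ih =>
    obtain ⟨F₁, hF₁, h₁⟩ := hF.exists_eq_sub_mul (hS w (Finset.mem_insert_self _ _))
      (hFS w (Finset.mem_insert_self _ _))
    obtain ⟨F₂, hF₂, h₂⟩ := ih hF₁ (fun v hv => hS v (Finset.mem_insert_of_mem hv))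
      (fun v hv => by
        have h := h₁ v
        rw [hFS v (Finset.mem_insert_of_mem hv)] at h
        have hvw : v - w ≠ 0 := sub_ne_zero.2 (fun e => hwS (e ▸ hv))
        exact (mul_eq_zero.1 h.symm).resolve_left hvw)
    refine ⟨F₂, hF₂, fun z => ?_⟩
    rw [h₁, h₂, Finset.prod_insert hwS, mul_assoc]

/-- A function holomorphic in the disc and continuous up to the boundary whose real part is
negative on the circle has no zeros in the disc. -/
theorem DiffContOnCl.ne_zero_of_re_neg {H : ℂ → ℂ} (hH : DiffContOnCl ℂ H (Metric.ball 0 1))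
    (hneg : ∀ z : ℂ, ‖z‖ = 1 → (H z).re < 0) {w : ℂ} (hw : w ∈ Metric.ball (0 : ℂ) 1) :
    H w ≠ 0 := by
  intro h0
  have hcl : closure (Metric.ball (0 : ℂ) 1) = Metric.closedBall 0 1 :=
    closure_ball _ one_ne_zero
  have hcont : ContinuousOn (fun z => (H z).re) (Metric.sphere (0 : ℂ) 1) :=
    Complex.continuous_re.comp_continuousOn
      (hH.continuousOn.mono (by rw [hcl]; exact Metric.sphere_subset_closedBall))
  obtain ⟨z₀, hz₀, hmax⟩ := (isCompact_sphere (0 : ℂ) 1).exists_isMaxOn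
    (NormedSpace.sphere_nonempty.2 zero_le_one) hcont
  -- Since `|exp H| = exp (Re H)`, the maximum modulus principle for `exp H` bounds `Re H` by its
  -- maximum on the circle, which is negative.
  have hexp : DiffContOnCl ℂ (fun z => Complex.exp (H z)) (Metric.ball 0 1) :=
    Complex.differentiable_exp.comp_diffContOnCl hH
  have key := Complex.norm_le_of_forall_mem_frontier_norm_le Metric.isBounded_ball hexp
    (C := Real.exp (H z₀).re) (fun z hz => by
      rw [frontier_ball _ one_ne_zero] at hz
      rw [Complex.norm_exp]
      exact Real.exp_le_exp.2 (hmax hz)) (subset_closure hw)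
  rw [h0, Complex.exp_zero, norm_one, Real.one_le_exp_iff] at key
  exact absurd (hneg z₀ (by simpa using hz₀)) (not_lt.2 key)

/-- If `Re (z⁻ᵈ G(z)) < 0` on the unit circle, then `G` does not vanish at `d + 1` distinct points
of the disc. -/
theorem DiffContOnCl.ne_zero_of_re_neg_of_zeros {G : ℂ → ℂ}
    (hG : DiffContOnCl ℂ G (Metric.ball 0 1)) (S : Finset ℂ)
    (hS : ∀ w ∈ S, w ∈ Metric.ball (0 : ℂ) 1) (hGS : ∀ w ∈ S, G w = 0)
    (hneg : ∀ z : ℂ, ‖z‖ = 1 → ∃ u : ℂ, G z = z ^ S.card * u ∧ u.re < 0)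
    {w : ℂ} (hw : w ∈ Metric.ball (0 : ℂ) 1) (hwS : w ∉ S) : G w ≠ 0 := by
  intro hGw
  obtain ⟨F, hF, hGF⟩ := hG.exists_eq_prod_sub_mul S hS hGS
  have hcl : closure (Metric.ball (0 : ℂ) 1) = Metric.closedBall 0 1 :=
    closure_ball _ one_ne_zero
  have hne : ∀ z ∈ closure (Metric.ball (0 : ℂ) 1), ∏ v ∈ S, (1 - conj v * z) ≠ 0 := by
    intro z hz
    rw [hcl, mem_closedBall_zero_iff] at hz
    exact Finset.prod_ne_zero_iff.2 fun v hv =>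
      one_sub_conj_mul_ne_zero_left (mem_ball_zero_iff.1 (hS v hv)) hz
  have hden : Differentiable ℂ (fun z : ℂ => ∏ v ∈ S, (1 - conj v * z)) := by fun_prop
  -- `G` is divided by `∏ (z - v) (1 - conj v z)`, which on the circle is `z ^ S.card` times a
  -- positive number: the power of `z` cancels and the sign of the real part survives.
  have hH : DiffContOnCl ℂ (fun z => (∏ v ∈ S, (1 - conj v * z))⁻¹ * F z) (Metric.ball 0 1) :=
    (hden.diffContOnCl.inv hne).smul hF
  refine hH.ne_zero_of_re_neg (fun z hz => ?_) hw ?_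
  · obtain ⟨u, hu, hure⟩ := hneg z hz
    have hz0 : z ≠ 0 := by
      rintro rfl
      simp at hz
    have hne' := hne z (by rw [hcl, mem_closedBall_zero_iff]; exact hz.le)
    set ν : ℝ := ∏ v ∈ S, ‖1 - conj v * z‖ ^ 2 with hν
    have hνpos : 0 < ν := Finset.prod_pos fun v hv =>
      pow_pos (norm_pos_iff.2 (one_sub_conj_mul_ne_zero_left
        (mem_ball_zero_iff.1 (hS v hv)) hz.le)) 2
    have hprod : (∏ v ∈ S, (z - v)) * ∏ v ∈ S, (1 - conj v * z) = z ^ S.card * (ν : ℂ) := by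
      rw [← Finset.prod_mul_distrib, Finset.prod_congr rfl
        (fun v _ => sub_mul_one_sub_conj_mul hz v), Finset.prod_mul_distrib, Finset.prod_const, hν]
      push_cast
      rfl
    have hνc : (ν : ℂ) ≠ 0 := by exact_mod_cast hνpos.ne'
    have hval : (∏ v ∈ S, (1 - conj v * z))⁻¹ * F z = ((ν⁻¹ : ℝ) : ℂ) * u := by
      have h1 := hGF z
      rw [hu] at h1
      have hzd : z ^ S.card ≠ 0 := pow_ne_zero _ hz0
      push_cast
      rw [inv_mul_eq_div, inv_mul_eq_div, div_eq_div_iff hne' hνc]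
      apply mul_left_cancel₀ hzd
      linear_combination (-F z) * hprod - (∏ v ∈ S, (1 - conj v * z)) * h1
    rw [hval, Complex.re_ofReal_mul]
    exact mul_neg_of_pos_of_neg (inv_pos.2 hνpos) hure
  · have h1 := hGF w
    rw [hGw] at h1
    have : ∏ v ∈ S, (w - v) ≠ 0 := Finset.prod_ne_zero_iff.2 fun v hv =>
      sub_ne_zero.2 fun e => hwS (e ▸ hv)
    simp [(mul_eq_zero.1 h1.symm).resolve_left this]

/-! ### The factors of an extremal -/

/-- The quotient of `(z - a) (1 - conj a z)` by a single factor of an extremal extends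
continuously to the closed disc, with the expected modulus on the circle. -/
theorem exists_diffContOnCl_factor {a b : ℂ} (ha : ‖a‖ ≤ 1) (hb : ‖b‖ < 1) {r : ℕ}
    (hr : r = 0 ∨ r = 1) {p : ℝ} (hp : 1 / 2 ≤ p) :
    ∃ B : ℂ → ℂ, DiffContOnCl ℂ B (Metric.ball 0 1) ∧
      (∀ z ∈ Metric.ball (0 : ℂ) 1,
        B z * (((z - a) / (1 - conj a * z)) ^ r *
          ((1 - conj a * z) / (1 - conj b * z)) ^ ((1 / p : ℝ) : ℂ)) =
            (z - a) * (1 - conj a * z)) ∧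
      ∀ z : ℂ, ‖z‖ = 1 → ‖B z‖ =
        (‖1 - conj a * z‖ / ‖1 - conj b * z‖) ^ (2 - 1 / p) * ‖1 - conj b * z‖ ^ 2 := by
  have hp0 : 0 < p := by linarith
  have hcl : closure (Metric.ball (0 : ℂ) 1) = Metric.closedBall 0 1 :=
    closure_ball _ one_ne_zero
  have hslit : ∀ z : ℂ, ‖conj a * z‖ < 1 → ‖z‖ ≤ 1 →
      (1 - conj a * z) / (1 - conj b * z) ∈ Complex.slitPlane := fun z h h' =>
    Complex.div_mem_slitPlane_of_re_pos (Complex.re_one_sub_pos h)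
      (Complex.re_one_sub_pos (norm_conj_mul_lt_one_left hb h'))
  -- For `|a| < 1` the base of the power stays in the slit plane on the closed disc, so a negative
  -- exponent is harmless. For `|a| = 1` the base vanishes at `z = a`; there `z - a = -a (1 - conj a
  -- z)` lets all powers merge into one of exponent `2 - 1/p ≥ 0`.
  rcases ha.lt_or_eq with ha1 | ha1
  · refine ⟨fun z => (z - a) ^ (1 - r) * (1 - conj a * z) ^ (1 + r) *
      ((1 - conj a * z) / (1 - conj b * z)) ^ ((-(1 / p) : ℝ) : ℂ), ?_, ?_, ?_⟩
    · apply DifferentiableOn.diffContOnCl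
      intro z hz
      rw [hcl, mem_closedBall_zero_iff] at hz
      have h1 := hslit z (norm_conj_mul_lt_one_left ha1 hz) hz
      have h2 := one_sub_conj_mul_ne_zero_left hb hz
      refine DifferentiableAt.differentiableWithinAt ?_
      refine DifferentiableAt.mul (by fun_prop) ?_
      exact DifferentiableAt.cpow_const (by fun_prop (disch := exact h2)) h1
    · intro z hz
      rw [mem_ball_zero_iff] at hz
      have h1 := hslit z (norm_conj_mul_lt_one_left ha1 hz.le) hz.le
      have h2 := one_sub_conj_mul_ne_zero_left ha1 hz.le
      have h3 := Complex.slitPlane_ne_zero h1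
      have h4 : ((1 - conj a * z) / (1 - conj b * z)) ^ ((-(1 / p) : ℝ) : ℂ) *
          ((1 - conj a * z) / (1 - conj b * z)) ^ ((1 / p : ℝ) : ℂ) = 1 := by
        rw [← Complex.cpow_add _ _ h3]
        simp
      have h5 : (z - a) ^ (1 - r) * (1 - conj a * z) ^ (1 + r) *
          ((z - a) / (1 - conj a * z)) ^ r = (z - a) * (1 - conj a * z) := by
        rcases hr with rfl | rfl
        · simp
        · simp only [Nat.sub_self, pow_zero, pow_one, one_mul]
          field_simp
      linear_combination ((z - a) ^ (1 - r) * (1 - conj a * z) ^ (1 + r) *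
          ((z - a) / (1 - conj a * z)) ^ r) * h4 + h5
    · intro z hz
      have hx : 0 < ‖1 - conj a * z‖ := norm_pos_iff.2 (one_sub_conj_mul_ne_zero_left ha1 hz.le)
      have hy : 0 < ‖1 - conj b * z‖ := norm_pos_iff.2 (one_sub_conj_mul_ne_zero_left hb hz.le)
      have h5 : ‖1 - conj a * z‖ ^ (1 - r) * ‖1 - conj a * z‖ ^ (1 + r) =
          ‖1 - conj a * z‖ ^ 2 := by
        rw [← pow_add]
        congr 1
        omega
      rw [norm_mul, norm_mul, norm_pow, norm_pow, norm_sub_eq_norm_one_sub_conj_mul hz, h5,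
        Complex.norm_cpow_real, norm_div, sub_eq_add_neg 2 (1 / p), Real.rpow_add (div_pos hx hy),
        Real.rpow_two, mul_right_comm, ← mul_pow, div_mul_cancel₀ _ hy.ne']
  · have hs : 0 ≤ 2 - 1 / p := by
      rw [sub_nonneg, div_le_iff₀ hp0]
      linarith
    have haa : a * conj a = 1 := by
      rw [Complex.mul_conj, Complex.normSq_eq_norm_sq, ha1]
      simp
    have hza : ∀ z : ℂ, z - a = -a * (1 - conj a * z) := fun z => by
      linear_combination (-z) * haa
    refine ⟨fun z => (-a) ^ (1 - r) * (1 - conj b * z) ^ 2 *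
      ((1 - conj a * z) / (1 - conj b * z)) ^ ((2 - 1 / p : ℝ) : ℂ), ⟨?_, ?_⟩, ?_, ?_⟩
    · intro z hz
      rw [mem_ball_zero_iff] at hz
      have h1 := hslit z (norm_conj_mul_lt_one_right ha hz) hz.le
      have h2 := one_sub_conj_mul_ne_zero_left hb hz.le
      refine DifferentiableAt.differentiableWithinAt ?_
      refine DifferentiableAt.mul (by fun_prop) ?_
      exact DifferentiableAt.cpow_const (by fun_prop (disch := exact h2)) h1
    · intro z hz
      rw [hcl, mem_closedBall_zero_iff] at hz
      have h2 := one_sub_conj_mul_ne_zero_left hb hz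
      refine ContinuousAt.continuousWithinAt ?_
      refine ContinuousAt.mul (by fun_prop) ?_
      -- For `p = 1/2` the exponent is `0` and the power is constantly `1`, even at base `0`;
      -- otherwise continuity at base `0` needs a positive exponent.
      rcases hs.eq_or_lt with hs0 | hs0
      · rw [← hs0]
        simp only [Complex.ofReal_zero, Complex.cpow_zero]
        exact continuousAt_const
      · have h3 : 0 ≤ ((1 - conj a * z) / (1 - conj b * z)).re ∨
            ((1 - conj a * z) / (1 - conj b * z)).im ≠ 0 := by
          have hw : ‖conj a * z‖ ≤ 1 := by
            rw [norm_mul, RCLike.norm_conj, ha1, one_mul]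
            exact hz
          rcases Complex.re_one_sub_pos_or_eq_one hw with h | h
          · exact (Complex.mem_slitPlane_iff.1 (Complex.div_mem_slitPlane_of_re_pos h
              (Complex.re_one_sub_pos (norm_conj_mul_lt_one_left hb hz)))).imp le_of_lt id
          · simp [h]
        have h4 : ContinuousAt (fun x : ℂ => x ^ ((2 - 1 / p : ℝ) : ℂ))
            ((1 - conj a * z) / (1 - conj b * z)) :=
          Complex.continuousAt_cpow_const_of_re_pos h3 (by rwa [Complex.ofReal_re])
        exact ContinuousAt.comp (f := fun z => (1 - conj a * z) / (1 - conj b * z)) h4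
          (by fun_prop (disch := exact h2))
    · intro z hz
      rw [mem_ball_zero_iff] at hz
      have h1 := hslit z (norm_conj_mul_lt_one_right ha hz) hz.le
      have h2 := one_sub_conj_mul_ne_zero_left hb hz.le
      have h3 := Complex.slitPlane_ne_zero h1
      have h6 := one_sub_conj_mul_ne_zero_right ha hz
      have h4 : ((1 - conj a * z) / (1 - conj b * z)) ^ ((2 - 1 / p : ℝ) : ℂ) *
          ((1 - conj a * z) / (1 - conj b * z)) ^ ((1 / p : ℝ) : ℂ) =
            ((1 - conj a * z) / (1 - conj b * z)) ^ 2 := by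
        rw [← Complex.cpow_add _ _ h3, ← Complex.ofReal_add, sub_add_cancel]
        simp
      have h5 : (-a) ^ (1 - r) * (-a) ^ r = -a := by
        rcases hr with rfl | rfl <;> simp
      have h7 : (z - a) / (1 - conj a * z) = -a := by
        rw [hza]
        field_simp
      have h8 : (1 - conj b * z) ^ 2 * ((1 - conj a * z) / (1 - conj b * z)) ^ 2 =
          (1 - conj a * z) ^ 2 := by
        field_simp
      rw [h7, hza]
      linear_combination ((-a) ^ (1 - r) * (-a) ^ r * (1 - conj b * z) ^ 2) * h4 +
        (-a) ^ (1 - r) * (-a) ^ r * h8 + (1 - conj a * z) ^ 2 * h5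
    · intro z hz
      rw [norm_mul, norm_mul, norm_pow, norm_pow, norm_neg, ha1, one_pow, one_mul,
        Complex.norm_cpow_real, norm_div, mul_comm]

/-! ### Extremality in convex ellipsoids -/

/-- The tangent line inequality for `x ↦ x ^ (2 p)` at `w`. -/
theorem rpow_tangent_le {p x w : ℝ} (hp : 1 / 2 ≤ p) (hx : 0 ≤ x) (hw : 0 ≤ w) :
    p * (w ^ (2 * p - 1) * x - w ^ (2 * p)) ≤ (x ^ (2 * p) - w ^ (2 * p)) / 2 := by
  rcases hw.eq_or_lt with rfl | hw
  · rw [Real.zero_rpow (x := 2 * p) (by linarith)]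
    -- At `p = 1/2` the slope `0 ^ (2 p - 1)` is `0 ^ 0 = 1`, and the inequality becomes an
    -- equality.
    rcases hp.eq_or_lt with rfl | hp
    · norm_num
      linarith
    · rw [Real.zero_rpow (by linarith)]
      have := Real.rpow_nonneg hx (2 * p)
      simp
      linarith
  -- Bernoulli's inequality for `(x / w) ^ (2 p)`, then scaling by `w ^ (2 p)`.
  · have h1 := one_add_mul_self_le_rpow_one_add (s := x / w - 1)
      (by linarith [div_nonneg hx hw.le]) (p := 2 * p) (by linarith)
    rw [add_sub_cancel, Real.div_rpow hx hw.le] at h1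
    have hpos : 0 < w ^ (2 * p) := Real.rpow_pos_of_pos hw _
    rw [le_div_iff₀ hpos] at h1
    have h2 : w ^ (2 * p - 1) = w ^ (2 * p) / w := Real.rpow_sub_one hw.ne' _
    have h3 : w ^ (2 * p - 1) * x = w ^ (2 * p) * (x / w) := by
      rw [h2]
      ring
    rw [h3]
    linarith

theorem HasEdigarianForm.differentiableOn {n m : ℕ} {p : Fin n → ℝ} {a : Fin n → ℂ}
    {α : Fin (m - 1) → Fin n → ℂ} {α₀ : Fin (m - 1) → ℂ} {r : Fin (m - 1) → Fin n → ℕ}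
    {f : ℂ → Fin n → ℂ} (hf : HasEdigarianForm m p a α α₀ r f) :
    DifferentiableOn ℂ f (Metric.ball 0 1) := by
  rw [differentiableOn_pi]
  intro j
  refine DifferentiableOn.congr ?_ (fun z hz => hf.formula z hz j)
  refine DifferentiableOn.const_mul ?_ _
  refine DifferentiableOn.fun_finsetProd fun k _ z hz => ?_
  rw [mem_ball_zero_iff] at hz
  have h1 := one_sub_conj_mul_ne_zero_right (hf.norm_α_le k j) hz
  have h2 := one_sub_conj_mul_ne_zero_left (hf.norm_α₀_lt k) hz.le
  refine DifferentiableAt.differentiableWithinAt ?_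
  refine DifferentiableAt.mul (by fun_prop (disch := exact h1)) ?_
  exact DifferentiableAt.cpow_const (by fun_prop (disch := exact h2))
    (Complex.div_mem_slitPlane_of_re_pos
      (Complex.re_one_sub_pos (norm_conj_mul_lt_one_right (hf.norm_α_le k j) hz))
      (Complex.re_one_sub_pos (norm_conj_mul_lt_one_left (hf.norm_α₀_lt k) hz.le)))

/-- A map of Edigarian's form in a convex ellipsoid does not agree at `m` points of the disc with
a map holomorphic near the closed disc. -/
theorem HasEdigarianForm.not_interpolated {n m : ℕ} {p : Fin n → ℝ} {a : Fin n → ℂ}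
    {α : Fin (m - 1) → Fin n → ℂ} {α₀ : Fin (m - 1) → ℂ} {r : Fin (m - 1) → Fin n → ℕ}
    {f : ℂ → Fin n → ℂ} (hf : HasEdigarianForm m p a α α₀ r f) (hp : ∀ j, 1 / 2 ≤ p j)
    {h : ℂ → Fin n → ℂ} (hh : HolomorphicNearClosedDisc (complexEllipsoid p) h)
    (S : Finset ℂ) (hcard : S.card = m - 1) (hS : ∀ w ∈ S, w ∈ Metric.ball (0 : ℂ) 1)
    (hhS : ∀ w ∈ S, h w = f w) {v : ℂ} (hv : v ∈ Metric.ball (0 : ℂ) 1) (hvS : v ∉ S) :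
    h v ≠ f v := by
  intro hhv
  have hcl : closure (Metric.ball (0 : ℂ) 1) = Metric.closedBall 0 1 :=
    closure_ball _ one_ne_zero
  obtain ⟨U, -, hU, hhd, hhm⟩ := hh
  choose b hb hbf hbn using fun k j => exists_diffContOnCl_factor (hf.norm_α_le k j)
    (hf.norm_α₀_lt k) (hf.r_mem k j) (hp j)
  let c : Fin n → ℝ := fun j => ‖a j‖ ^ (2 * p j)
  -- Chosen so that `B j * f j = P j` in the disc.
  let B : Fin n → ℂ → ℂ := fun j z => (c j : ℂ) / a j * ∏ k, b k j z
  let P : Fin n → ℂ → ℂ := fun j z =>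
    (c j : ℂ) * ∏ k, ((z - α k j) * (1 - conj (α k j) * z))
  let G : ℂ → ℂ := fun z => ∑ j, (p j : ℂ) * (B j z * h z j - P j z)
  have hG : DiffContOnCl ℂ G (Metric.ball 0 1) := by
    have hhj : ∀ j, DifferentiableOn ℂ (fun z => h z j) (Metric.closedBall 0 1) := fun j =>
      (differentiableOn_pi.1 hhd j).mono hU
    constructor
    · have hbd : ∀ k j, DifferentiableOn ℂ (b k j) (Metric.ball 0 1) := fun k j =>
        (hb k j).differentiableOn
      have hhj' : ∀ j, DifferentiableOn ℂ (fun z => h z j) (Metric.ball 0 1) := fun j =>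
        (hhj j).mono Metric.ball_subset_closedBall
      refine DifferentiableOn.fun_sum fun j _ => ?_
      refine DifferentiableOn.const_mul (DifferentiableOn.sub (DifferentiableOn.mul ?_ (hhj' j))
        (by fun_prop)) _
      exact (DifferentiableOn.fun_finsetProd fun k _ => hbd k j).const_mul _
    · refine continuousOn_finsetSum _ fun j _ => ?_
      refine continuousOn_const.mul (ContinuousOn.sub (ContinuousOn.mul ?_ ?_) (by fun_prop))
      · exact continuousOn_const.mul
          (continuousOn_finsetProd _ fun k _ => (hb k j).continuousOn)
      · rw [hcl]
        exact (hhj j).continuousOn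
  have hzero : ∀ z ∈ Metric.ball (0 : ℂ) 1, h z = f z → G z = 0 := by
    intro z hz hhz
    refine Finset.sum_eq_zero fun j _ => ?_
    have h1 : B j z * h z j = P j z := by
      have h2 := Finset.prod_congr (rfl : Finset.univ = Finset.univ) fun k _ => hbf k j z hz
      rw [Finset.prod_mul_distrib] at h2
      have h3 := hf.a_ne_zero j
      simp only [B, P]
      rw [hhz, hf.formula z hz j, ← h2]
      field_simp
    rw [h1, sub_self, mul_zero]
  refine hG.ne_zero_of_re_neg_of_zeros S hS (fun w hw => hzero w (hS w hw) (hhS w hw)) ?_ hv hvS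
    (hzero v hv hhv)
  intro z hz
  rw [hcard]
  have hz0 : z ≠ 0 := by
    rintro rfl
    simp at hz
  let x : Fin (m - 1) → Fin n → ℝ := fun k j => ‖1 - conj (α k j) * z‖
  let y : Fin (m - 1) → ℝ := fun k => ‖1 - conj (α₀ k) * z‖
  let D : ℝ := ∏ k, y k ^ 2
  let T : Fin n → ℝ := fun j => ∏ k, (x k j / y k)
  -- The modulus of the boundary value of `f j` at `z`: the Blaschke factors have modulus `1` there.
  let w : Fin n → ℝ := fun j => ‖a j‖ * T j ^ (1 / p j)
  have hy : ∀ k, 0 < y k := fun k =>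
    norm_pos_iff.2 (one_sub_conj_mul_ne_zero_left (hf.norm_α₀_lt k) hz.le)
  have hD : 0 < D := Finset.prod_pos fun k _ => pow_pos (hy k) 2
  have hxy : ∀ k j, 0 ≤ x k j / y k := fun k j => div_nonneg (norm_nonneg _) (hy k).le
  have hT : ∀ j, 0 ≤ T j := fun j => Finset.prod_nonneg fun k _ => hxy k j
  have hw : ∀ j, 0 ≤ w j := fun j => mul_nonneg (norm_nonneg _) (Real.rpow_nonneg (hT j) _)
  have hp0 : ∀ j, 0 < p j := fun j => by linarith [hp j]
  have ha0 : ∀ j, 0 < ‖a j‖ := fun j => norm_pos_iff.2 (hf.a_ne_zero j)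
  have hwP : ∀ j, c j * ∏ k, x k j ^ 2 = w j ^ (2 * p j) * D := by
    intro j
    have h1 : (T j ^ (1 / p j)) ^ (2 * p j) = T j ^ 2 := by
      rw [← Real.rpow_mul (hT j), ← Real.rpow_two]
      congr 1
      have := (hp0 j).ne'
      field_simp
    have h2 : T j ^ 2 * D = ∏ k, x k j ^ 2 := by
      simp only [T, D]
      rw [← Finset.prod_pow, ← Finset.prod_mul_distrib]
      refine Finset.prod_congr rfl fun k _ => ?_
      have := (hy k).ne'
      field_simp
    simp only [w]
    rw [Real.mul_rpow (norm_nonneg _) (Real.rpow_nonneg (hT j) _), h1, mul_assoc, h2]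
  have hwB : ∀ j, ‖B j z‖ = w j ^ (2 * p j - 1) * D := by
    intro j
    have h1 : (T j ^ (1 / p j)) ^ (2 * p j - 1) = T j ^ (2 - 1 / p j) := by
      rw [← Real.rpow_mul (hT j)]
      congr 1
      have := (hp0 j).ne'
      field_simp
    have h2 : ‖∏ k, b k j z‖ = T j ^ (2 - 1 / p j) * D := by
      rw [norm_prod, Finset.prod_congr rfl fun k _ => hbn k j z hz, Finset.prod_mul_distrib,
        Real.finsetProd_rpow _ _ fun k _ => hxy k j]
    have h3 : ‖(c j : ℂ) / a j‖ = ‖a j‖ ^ (2 * p j - 1) := by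
      rw [norm_div, Complex.norm_of_nonneg (Real.rpow_nonneg (norm_nonneg _) _),
        Real.rpow_sub_one (ha0 j).ne']
    simp only [B, w]
    rw [norm_mul, h2, h3, Real.mul_rpow (norm_nonneg _) (Real.rpow_nonneg (hT j) _), h1, mul_assoc]
  have hPz : ∀ j, P j z = z ^ (m - 1) * ((w j ^ (2 * p j) * D : ℝ) : ℂ) := by
    intro j
    rw [← hwP j]
    simp only [P]
    rw [Finset.prod_congr rfl fun k _ => sub_mul_one_sub_conj_mul hz (α k j),
      Finset.prod_mul_distrib, Finset.prod_const, Finset.card_univ, Fintype.card_fin]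
    push_cast
    ring
  have hzm : z ^ (m - 1) ≠ 0 := pow_ne_zero _ hz0
  -- The polynomial identity, read on the circle, says that the boundary values of `f` lie on the
  -- boundary of the ellipsoid.
  have hsum : ∑ j, w j ^ (2 * p j) = 1 := by
    have h1 : ∑ j, P j z = z ^ (m - 1) * (D : ℂ) := by
      refine (hf.sum_eq z).trans ?_
      rw [Finset.prod_congr rfl fun k _ => sub_mul_one_sub_conj_mul hz (α₀ k),
        Finset.prod_mul_distrib, Finset.prod_const, Finset.card_univ, Fintype.card_fin]
      simp only [D, y]
      push_cast
      rfl
    rw [Finset.sum_congr rfl fun j _ => hPz j, ← Finset.mul_sum] at h1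
    have h2 := mul_left_cancel₀ hzm h1
    rw [← Complex.ofReal_sum, Complex.ofReal_inj, ← Finset.sum_mul] at h2
    exact mul_right_cancel₀ hD.ne' (h2.trans (one_mul D).symm)
  have hhz : ∑ j, ‖h z j‖ ^ (2 * p j) < 1 :=
    hhm (hU (mem_closedBall_zero_iff.2 hz.le))
  refine ⟨∑ j, (p j : ℂ) * (B j z * h z j / z ^ (m - 1) - ((w j ^ (2 * p j) * D : ℝ) : ℂ)), ?_, ?_⟩
  · rw [Finset.mul_sum]
    refine Finset.sum_congr rfl fun j _ => ?_
    rw [hPz j]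
    field_simp
  · rw [Complex.re_sum]
    calc ∑ j, ((p j : ℂ) * (B j z * h z j / z ^ (m - 1) - ((w j ^ (2 * p j) * D : ℝ) : ℂ))).re
        ≤ ∑ j, D * ((‖h z j‖ ^ (2 * p j) - w j ^ (2 * p j)) / 2) := by
          refine Finset.sum_le_sum fun j _ => ?_
          have h1 : (B j z * h z j / z ^ (m - 1)).re ≤ w j ^ (2 * p j - 1) * D * ‖h z j‖ := by
            refine (Complex.re_le_norm _).trans_eq ?_
            rw [norm_div, norm_mul, norm_pow, hz, one_pow, div_one, hwB]
          rw [Complex.re_ofReal_mul, Complex.sub_re, Complex.ofReal_re]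
          calc p j * ((B j z * h z j / z ^ (m - 1)).re - w j ^ (2 * p j) * D)
              ≤ p j * (w j ^ (2 * p j - 1) * D * ‖h z j‖ - w j ^ (2 * p j) * D) := by
                gcongr
                exact (hp0 j).le
            _ = D * (p j * (w j ^ (2 * p j - 1) * ‖h z j‖ - w j ^ (2 * p j))) := by ring
            _ ≤ _ := by
                gcongr
                exact rpow_tangent_le (hp j) (norm_nonneg _) (hw j)
      _ = D * ((∑ j, ‖h z j‖ ^ (2 * p j) - 1) / 2) := by
          rw [← Finset.mul_sum, ← Finset.sum_div, Finset.sum_sub_distrib, hsum]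
      _ < 0 := mul_neg_of_pos_of_neg hD (by linarith)

/-- In a convex ellipsoid a map of Edigarian's form with parameter `m` is an `l`-extremal for
every `l ≥ m`. -/
theorem HasEdigarianForm.isExtremal {n m : ℕ} (hm : 1 ≤ m) {p : Fin n → ℝ} {a : Fin n → ℂ}
    {α : Fin (m - 1) → Fin n → ℂ} {α₀ : Fin (m - 1) → ℂ} {r : Fin (m - 1) → Fin n → ℕ}
    {f : ℂ → Fin n → ℂ} (hf : HasEdigarianForm m p a α α₀ r f) (hp : ∀ j, 1 / 2 ≤ p j)
    {l : ℕ} (hl : m ≤ l) : IsExtremal (complexEllipsoid p) l f := by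
  refine ⟨hf.differentiableOn, hf.mapsTo, fun pt hinj hpt =>
    ⟨hf.differentiableOn, hf.mapsTo, ?_⟩⟩
  rintro ⟨h, hh, heq⟩
  -- The first `m - 1` points are the zeros to be divided out; the point of index `m - 1` is the
  -- forbidden extra zero.
  let e : Fin (m - 1) ↪ ℂ := ⟨fun i => pt ⟨i, by omega⟩, fun i k hik => by
    have := hinj hik
    simp only [Fin.mk.injEq] at this
    exact Fin.ext this⟩
  refine hf.not_interpolated hp hh (Finset.univ.map e) (by simp) ?_ ?_
    (hpt ⟨m - 1, by omega⟩) ?_ (heq _)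
  · intro w hw
    obtain ⟨i, -, rfl⟩ := Finset.mem_map.1 hw
    exact hpt _
  · intro w hw
    obtain ⟨i, -, rfl⟩ := Finset.mem_map.1 hw
    exact heq _
  · intro hw
    obtain ⟨i, -, hi⟩ := Finset.mem_map.1 hw
    have := hinj hi
    simp only [Fin.mk.injEq] at this
    omega

/-! ### The set `𝒮ₙ` and the conclusion -/

theorem MemS.half_le {n : ℕ} {q : Fin n → ℝ} (hq : MemS q) (j : Fin n) : 1 / 2 ≤ q j := by
  induction hq generalizing j with
  | half => exact le_rfl
  | scale c p hc _ ih => nlinarith [ih j]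
  | replace p q _ h ih =>
    rcases h j with h | ⟨i, h⟩
    · rw [h]
      norm_num
    · rw [h]
      exact ih i

theorem mainTheorem4 (n m : ℕ) (hm : 2 ≤ m) (p q : Fin n → ℝ) (hp : ∀ j, 0 < p j)
    (hq : MemS q) (a : Fin n → ℂ) (α : Fin (m - 1) → Fin n → ℂ) (α₀ : Fin (m - 1) → ℂ)
    (r : Fin (m - 1) → Fin n → ℕ) (f : ℂ → Fin n → ℂ)
    (hf : HasEdigarianForm m p a α α₀ r f) :
    ((∀ j, 1 / 2 ≤ p j) →
      ∀ J : Finset (Fin n), (∀ j, j ∈ J ↔ ¬ IsPosNat (p j / q j)) →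
      (∀ j ∈ J, ∀ k, ‖α k j‖ < 1 ∧ r k j = 0) →
      ∀ s : Fin n → ℕ, (∀ j, s j = (Finset.univ.filter (fun k => r k j = 1)).card) →
      ∃ m' : ℕ, (m' : ℝ) = m + ∑ j ∈ Jᶜ, (p j / q j - 1) * s j ∧
        IsExtremal (complexEllipsoid p) m' f) ∧
    ((∀ j, IsPosNat (p j / q j)) →
      ∃ m' : ℕ, (m' : ℝ) = m + ((m : ℝ) - 1) * (∑ j, p j / q j - n) ∧
        IsExtremal (complexEllipsoid p) m' f) := by
  have hnat : ∀ j, IsPosNat (p j / q j) → ∃ N : ℕ, p j / q j - 1 = N := by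
    rintro j ⟨N, hN, h⟩
    exact ⟨N - 1, by rw [h, Nat.cast_sub hN, Nat.cast_one]⟩
  constructor
  · intro hp' J hJ _ s _
    have hN : ∀ j, ∃ N : ℕ, j ∈ Jᶜ → p j / q j - 1 = N := fun j => by
      by_cases hj : IsPosNat (p j / q j)
      · obtain ⟨N, h⟩ := hnat j hj
        exact ⟨N, fun _ => h⟩
      -- The value on `J` is arbitrary, as the sum runs over `Jᶜ`.
      · exact ⟨0, fun h => absurd ((hJ j).2 hj) (Finset.mem_compl.1 h)⟩
    choose N hN using hN
    refine ⟨m + ∑ j ∈ Jᶜ, N j * s j, ?_, hf.isExtremal (by omega) hp' (by omega)⟩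
    push_cast
    congr 1
    exact Finset.sum_congr rfl fun j hj => by rw [hN j hj]
  · intro hpq
    choose N hN using fun j => hnat j (hpq j)
    -- A positive integer quotient gives `p j ≥ q j`, so the ellipsoid is convex here too.
    have hp' : ∀ j, 1 / 2 ≤ p j := fun j => by
      have h1 := hq.half_le j
      have h2 : 1 ≤ p j / q j := by
        have := hN j
        have : (0 : ℝ) ≤ N j := Nat.cast_nonneg _
        linarith
      rw [one_le_div (by linarith)] at h2
      linarith
    refine ⟨m + (m - 1) * ∑ j, N j, ?_, hf.isExtremal (by omega) hp' (by omega)⟩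
    have h1 : ∑ j, p j / q j - n = ((∑ j, N j : ℕ) : ℝ) := by
      push_cast
      rw [← Finset.sum_congr rfl fun j _ => hN j, Finset.sum_sub_distrib]
      simp
    rw [h1, Nat.cast_add, Nat.cast_mul, Nat.cast_sub (by omega), Nat.cast_one]
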